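/- Let $\Lambda=\mathbb C[\mathbf p_1,\mathbf p_2,\dots]$ be the algebra of symmetric functions over $\mathbb C$, generated by the power sums, and put $$H(u)=1+\sum_{k\ge1}\frac{h_k}{u^k}=\exp\Big(\sum_{k\ge1}\frac{\mathbf p_k}{k\,u^k}\Big),\qquad E(v)=1+\sum_{k\ge1}\frac{e_k}{v^k}=\exp\Big(\sum_{k\ge1}\frac{(-1)^{k-1}\mathbf p_k}{k\,v^k}\Big),$$ so that $h_k$ and $e_k$ are the complete homogeneous and the elementary symmetric functions. Let $a=(a_i)_{i\in\mathbb Z}$ be an arbitrary sequence of complex numbers. Write $\widehat a_i=-a_{-i+1}$, $(\tau^r a)_i=a_{i+r}$ for $r\in\mathbb Z$, and $(u\,|\,a)^m=(u-a_1)\cdots(u-a_m)$. The elements $h_{k;a}\in\Lambda$ are defined by $$1+\sum_{k\ge1}\frac{h_{k;a}}{(u\,|\,a)^k}=H(u)\quad\text{in }\Lambda[[u^{-1}]],$$ together with $h_{0;a}=1$ and $h_{k;a}=0$ for $k<0$. The multiparameter Schur function of a Young diagram $\mu$ is $s_{\mu;a}=\det[h_{\mu_i-i+j;\,\tau^{1-j}a}]$,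 where the order of the determinant is the number of rows of $\mu$ (or any larger number). For $p,q\ge0$ let $(p\,|\,q)$ denote the hook diagram $(p+1,1^q)$. Then the series $$\sum_{p,q=0}^\infty\frac{s_{(p|q);a}}{(u\,|\,a)^{p+1}(v\,|\,\widehat a)^{q+1}}$$ converges in $\Lambda[[u^{-1},v^{-1}]]$ (coefficientwise), and $$1+(u+v)\sum_{p,q=0}^\infty\frac{s_{(p|q);a}}{(u\,|\,a)^{p+1}(v\,|\,\widehat a)^{q+1}}=H(u)E(v).$$ Equivalently, for all $p,q\ge0$ (and both statements hold), $$s_{(p+1|q);a}+s_{(p|q+1);a}+(a_{p+1}+\widehat a_{q+1})\,s_{(p|q);a}=s_{(p|0);a}\,s_{(0|q);a}.$$ -/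

import Mathlib

namespace MultiSchur

open PowerSeries
open scoped PowerSeries.WithPiTopology

noncomputable section

/-! ### The algebra of symmetric functions and the series `H` and `E` -/

/-- The algebra `Λ` of symmetric functions over `ℂ`: the polynomial algebra `ℂ[𝐩₁, 𝐩₂, …]` in the
power sums. The variable with index `i` stands for `𝐩_{i+1}`. -/
abbrev Sym : Type := MvPolynomial ℕ ℂ

/-- `Λ` is discrete, so that infinite sums of formal series with coefficients in `Λ` are
the formal (coefficientwise finite) ones. -/
instance : TopologicalSpace Sym := ⊥

instance : DiscreteTopology Sym := ⟨rfl⟩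

/-- The power sum `𝐩_k`, for `k ≥ 1`. -/
def powerSum (k : ℕ) : Sym := MvPolynomial.X (k - 1)

/-- The exponent `∑_{k ≥ 1} 𝐩_k t^k / k`. -/
def hExponent : PowerSeries Sym :=
  PowerSeries.mk fun k => if k = 0 then 0 else MvPolynomial.C ((k : ℂ)⁻¹) * powerSum k

/-- The exponent `∑_{k ≥ 1} (-1)^{k-1} 𝐩_k t^k / k`. -/
def eExponent : PowerSeries Sym :=
  PowerSeries.mk fun k =>
    if k = 0 then 0 else MvPolynomial.C ((-1) ^ (k - 1) * (k : ℂ)⁻¹) * powerSum k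

/-- The generating series `H(u) = 1 + ∑_{k ≥ 1} h_k / u^k = exp (∑ 𝐩_k u^{-k} / k)` of the complete
homogeneous symmetric functions, as an element of `Λ[[u⁻¹]]`. The variable `X` of the power
series ring is `u⁻¹`. -/
def H : PowerSeries Sym := (PowerSeries.exp Sym).subst hExponent

/-- The generating series `E(v) = 1 + ∑_{k ≥ 1} e_k / v^k = exp (∑ (-1)^{k-1} 𝐩_k v^{-k} / k)` of
the elementary symmetric functions, as an element of `Λ[[v⁻¹]]`. The variable `X` of the power
series ring is `v⁻¹`. -/
def E : PowerSeries Sym := (PowerSeries.exp Sym).subst eExponent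

theorem hasSubst_hExponent : PowerSeries.HasSubst hExponent :=
  PowerSeries.HasSubst.of_constantCoeff_zero' (by
    rw [← PowerSeries.coeff_zero_eq_constantCoeff_apply]; simp [hExponent])

/-- `H(u) E(-u) = 1`. -/
theorem H_mul_E_neg : H * PowerSeries.evalNegHom E = 1 := by
  have hE : PowerSeries.HasSubst eExponent :=
    PowerSeries.HasSubst.of_constantCoeff_zero' (by
      rw [← PowerSeries.coeff_zero_eq_constantCoeff_apply]; simp [eExponent])
  have key : PowerSeries.evalNegHom E
      = (PowerSeries.evalNegHom (PowerSeries.exp Sym)).subst hExponent := by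
    unfold PowerSeries.evalNegHom E
    rw [PowerSeries.rescale_eq_subst, PowerSeries.rescale_eq_subst,
      PowerSeries.subst_comp_subst_apply hE (PowerSeries.HasSubst.smul_X' _),
      PowerSeries.subst_comp_subst_apply (PowerSeries.HasSubst.smul_X' _) hasSubst_hExponent,
      ← PowerSeries.rescale_eq_subst, PowerSeries.subst_smul hasSubst_hExponent,
      PowerSeries.subst_X hasSubst_hExponent]
    congr 1
    ext1 n
    rcases n with _ | n
    · simp [hExponent, eExponent]
    · simp only [eExponent, hExponent, PowerSeries.coeff_rescale, PowerSeries.coeff_mk,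
        Nat.succ_ne_zero, if_false, Nat.add_sub_cancel, map_mul, map_pow, map_neg, map_one,
        neg_smul, one_smul]
      have h1 : ((-1 : Sym) ^ n) * (-1) ^ n = 1 := by rw [← mul_pow]; simp
      rw [pow_succ]
      linear_combination (-(MvPolynomial.C (((n + 1 : ℕ) : ℂ)⁻¹) * powerSum (n + 1))) * h1
  rw [key, H, ← PowerSeries.subst_mul hasSubst_hExponent, PowerSeries.exp_mul_exp_neg_eq_one,
    ← PowerSeries.coe_substAlgHom hasSubst_hExponent, map_one]

/-! ### Sequences of parameters and generalized powers -/

/-- The shifted sequence `(τ^r a)_i = a_{i+r}`. -/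
def shift (r : ℤ) (a : ℤ → ℂ) : ℤ → ℂ := fun i => a (i + r)

/-- The dual sequence `â_i = -a_{-i+1}`. -/
def dual (a : ℤ → ℂ) : ℤ → ℂ := fun i => -a (-i + 1)

/-- The series `1 / (u - c) = ∑_{n ≥ 0} c^n u^{-n-1}` in `Λ[[u⁻¹]]`. -/
def recip (c : ℂ) : PowerSeries Sym :=
  X * PowerSeries.mk fun n => MvPolynomial.C (c ^ n)

/-- The series `1 / (u|a)^m` in `Λ[[u⁻¹]]`, where `(u|a)^m = (u - a_1) ⋯ (u - a_m)`. -/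
def recipPow (a : ℤ → ℂ) (m : ℕ) : PowerSeries Sym :=
  ∏ i ∈ Finset.range m, recip (a ((i : ℤ) + 1))

/-- `(1 - c u⁻¹) ⬝ 1 / (u - c) = u⁻¹`. -/
theorem recip_spec (c : ℂ) :
    (1 - PowerSeries.C (MvPolynomial.C c : Sym) * X) * recip c = X := by
  ext1 n
  rw [recip, sub_mul, one_mul, mul_assoc, map_sub, PowerSeries.coeff_C_mul]
  rcases n with _ | _ | n
  · simp
  · simp [PowerSeries.coeff_succ_X_mul]
  · simp [PowerSeries.coeff_succ_X_mul, PowerSeries.coeff_X, pow_succ']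

/-- `1 / (u|a)^m` is `u^{-m}` times a series with constant term `1`. -/
theorem recipPow_eq (a : ℤ → ℂ) (m : ℕ) :
    ∃ g : PowerSeries Sym, PowerSeries.constantCoeff g = 1 ∧ recipPow a m = X ^ m * g := by
  refine ⟨∏ i ∈ Finset.range m,
    PowerSeries.mk fun n => (MvPolynomial.C (a ((i : ℤ) + 1) ^ n) : Sym), ?_, ?_⟩
  · rw [map_prod]
    refine Finset.prod_eq_one fun i _ => ?_
    rw [← PowerSeries.coeff_zero_eq_constantCoeff_apply]; simp
  · simp [recipPow, recip, Finset.prod_mul_distrib]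

theorem coeff_recipPow_of_lt (a : ℤ → ℂ) {n m : ℕ} (h : n < m) :
    PowerSeries.coeff n (recipPow a m) = 0 := by
  obtain ⟨g, -, hg⟩ := recipPow_eq a m
  rw [hg, PowerSeries.coeff_X_pow_mul', if_neg (by omega)]

theorem coeff_recipPow_self (a : ℤ → ℂ) (m : ℕ) :
    PowerSeries.coeff m (recipPow a m) = 1 := by
  obtain ⟨g, h1, hg⟩ := recipPow_eq a m
  rw [hg, PowerSeries.coeff_X_pow_mul', if_pos le_rfl, Nat.sub_self,
    PowerSeries.coeff_zero_eq_constantCoeff_apply, h1]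

/-! ### Multiparameter complete functions -/

/-- The elements `h_{k;a}`, `k ≥ 0`: the solution of the triangular system
`∑_{k ≥ 0} h_{k;a} / (u|a)^k = H(u)`, see `hasSum_hRow` and `eq_hRow`. -/
def hRow (a : ℤ → ℂ) (k : ℕ) : Sym :=
  PowerSeries.coeff k H - ∑ j : Fin k, hRow a j * PowerSeries.coeff k (recipPow a j)
termination_by k
decreasing_by exact j.2

theorem sum_hRow (a : ℤ → ℂ) (n : ℕ) :
    ∑ k ∈ Finset.range (n + 1), hRow a k * PowerSeries.coeff n (recipPow a k)
      = PowerSeries.coeff n H := by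
  rw [Finset.sum_range_succ, coeff_recipPow_self, mul_one]
  conv_lhs => rw [hRow]
  rw [Finset.sum_range (fun k => hRow a k * PowerSeries.coeff n (recipPow a k))]
  ring

theorem hasSum_iff_sum_range (a : ℤ → ℂ) (h : ℕ → Sym) (F : PowerSeries Sym) :
    HasSum (fun k => PowerSeries.C (h k) * recipPow a k) F ↔
      ∀ n, ∑ k ∈ Finset.range (n + 1), h k * PowerSeries.coeff n (recipPow a k)
        = PowerSeries.coeff n F := by
  rw [PowerSeries.WithPiTopology.hasSum_iff_hasSum_coeff]
  refine forall_congr' fun n => ?_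
  have hs : HasSum (fun k => PowerSeries.coeff n (PowerSeries.C (h k) * recipPow a k))
      (∑ k ∈ Finset.range (n + 1), PowerSeries.coeff n (PowerSeries.C (h k) * recipPow a k)) :=
    hasSum_sum_of_ne_finset_zero fun k hk => by
      rw [PowerSeries.coeff_C_mul, coeff_recipPow_of_lt, mul_zero]
      simpa [Nat.lt_succ_iff] using hk
  simp only [PowerSeries.coeff_C_mul] at hs ⊢
  exact ⟨fun h' => hs.unique h', fun h' => h' ▸ hs⟩

/-- The defining relation `∑_{k ≥ 0} h_{k;a} / (u|a)^k = H(u)`. -/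
theorem hasSum_hRow (a : ℤ → ℂ) :
    HasSum (fun k => PowerSeries.C (hRow a k) * recipPow a k) H :=
  (hasSum_iff_sum_range a _ _).2 (sum_hRow a)

/-- The defining relation determines the elements `h_{k;a}`. -/
theorem eq_hRow (a : ℤ → ℂ) (h : ℕ → Sym)
    (hh : HasSum (fun k => PowerSeries.C (h k) * recipPow a k) H) : h = hRow a := by
  rw [hasSum_iff_sum_range] at hh
  funext n
  induction n using Nat.strong_induction_on with
  | _ n ih =>
    have e := (hh n).trans (sum_hRow a n).symm
    rw [Finset.sum_range_succ, Finset.sum_range_succ, coeff_recipPow_self, mul_one, mul_one,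
      Finset.sum_congr rfl fun k hk => by rw [ih k (Finset.mem_range.1 hk)]] at e
    exact add_left_cancel e

theorem hRow_zero (a : ℤ → ℂ) : hRow a 0 = 1 := by
  have h : PowerSeries.constantCoeff H = 1 := by
    have := PowerSeries.constantCoeff_subst_eq_zero (a := hExponent)
      (by
        change PowerSeries.constantCoeff hExponent = 0
        rw [← PowerSeries.coeff_zero_eq_constantCoeff_apply]; simp [hExponent])
      (PowerSeries.exp Sym - 1) (by simp)
    rw [PowerSeries.subst_sub hasSubst_hExponent,
      ← PowerSeries.coe_substAlgHom hasSubst_hExponent, map_one,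
      PowerSeries.coe_substAlgHom, map_sub, map_one, sub_eq_zero] at this
    exact this
  rw [hRow]
  simp [h]

/-- The elements `h_{k;a}` for all integers `k`, with `h_{k;a} = 0` for `k < 0`. -/
def hInt (a : ℤ → ℂ) : ℤ → Sym
  | Int.ofNat k => hRow a k
  | Int.negSucc _ => 0

/-! ### Multiparameter Schur functions -/

/-- The determinant `det [h_{μ_i - i + j; τ^{1-j} a}]` of order `N`. Rows and columns are numbered
from `0` here, so that `τ^{1-j}` becomes `τ^{-j}`. -/
def jacobiTrudi (N : ℕ) (μ : YoungDiagram) (a : ℤ → ℂ) : Sym :=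
  Matrix.det (Matrix.of fun i j : Fin N =>
    hInt (shift (-((j : ℕ) : ℤ)) a) ((μ.rowLen i : ℤ) - ((i : ℕ) : ℤ) + ((j : ℕ) : ℤ)))

/-- The multiparameter Schur function `s_{μ;a} = det [h_{μ_i - i + j; τ^{1-j} a}]`; the order of the
determinant is the number `ℓ(μ)` of rows of `μ`, and any larger order gives the same element, see
`jacobiTrudi_eq`. -/
def schur (μ : YoungDiagram) (a : ℤ → ℂ) : Sym := jacobiTrudi (μ.colLen 0) μ a

theorem jacobiTrudi_eq (μ : YoungDiagram) (a : ℤ → ℂ) (N : ℕ) (hN : μ.colLen 0 ≤ N) :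
    jacobiTrudi N μ a = schur μ a := by
  induction N, hN using Nat.le_induction with
  | base => rfl
  | succ N hN ih =>
    have hrow : μ.rowLen N = 0 := by
      by_contra hne
      have h1 : (N, 0) ∈ μ := YoungDiagram.mem_iff_lt_rowLen.2 (Nat.pos_of_ne_zero hne)
      have h2 := YoungDiagram.mem_iff_lt_colLen.1 h1
      omega
    rw [← ih, jacobiTrudi, Matrix.det_succ_row _ (Fin.last N), Fin.sum_univ_castSucc]
    rw [Finset.sum_eq_zero, zero_add]
    · have : (μ.rowLen N : ℤ) - (N : ℤ) + (N : ℤ) = Int.ofNat 0 := by simp [hrow]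
      have h1 : ∀ b, hInt b (Int.ofNat 0) = 1 := fun b => hRow_zero b
      simp only [Matrix.of_apply, Fin.val_last, this, h1]
      rw [← two_mul, pow_mul, neg_one_sq, one_pow, one_mul, one_mul]
      simp [jacobiTrudi, Matrix.submatrix, Fin.succAbove_last]
    · intro j _
      have : (μ.rowLen N : ℤ) - (N : ℤ) + ((j : ℕ) : ℤ) = Int.negSucc (N - 1 - j) := by
        have := j.2
        omega
      simp [this, hInt]

/-- The hook Young diagram `(p|q) = (p+1, 1^q)`. -/
def hook (p q : ℕ) : YoungDiagram :=
  YoungDiagram.ofRowLens ((p + 1) :: List.replicate q 1) (by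
    rw [List.sortedGE_iff_pairwise, List.pairwise_cons]
    refine ⟨fun x hx => ?_, ?_⟩
    · rw [List.eq_of_mem_replicate hx]; omega
    · exact List.pairwise_replicate.2 (Or.inr le_rfl))

/-- The hook function `s_{(p|q);a}`. -/
def hookSchur (p q : ℕ) (a : ℤ → ℂ) : Sym := schur (hook p q) a

/-! ### Formal series in `u⁻¹` and `v⁻¹` -/

/-- The algebra `Λ[[u⁻¹, v⁻¹]] = Λ[[u⁻¹]][[v⁻¹]]`, with the topology of coefficientwise
convergence. -/
abbrev Series2 : Type := PowerSeries (PowerSeries Sym)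

/-- `Λ[[u⁻¹]] → Λ[[u⁻¹, v⁻¹]]`. -/
def inU : PowerSeries Sym →+* Series2 := PowerSeries.C

/-- `Λ[[v⁻¹]] → Λ[[u⁻¹, v⁻¹]]`. -/
def inV : PowerSeries Sym →+* Series2 := PowerSeries.map PowerSeries.C

/-- The multiplicative set generated by the elements `u⁻¹` and `v⁻¹` of `Λ[[u⁻¹, v⁻¹]]`. -/
def denominators : Submonoid Series2 := Submonoid.closure {inU X, inV X}

/-- The ring `Λ[[u⁻¹, v⁻¹]][u, v]`: the localization of `Λ[[u⁻¹, v⁻¹]]` that inverts `u⁻¹`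
and `v⁻¹`. -/
abbrev Laurent2 : Type := Localization denominators

/-- The element `u`, the inverse of `u⁻¹`. -/
def u : Laurent2 := Localization.mk 1 ⟨inU X, Submonoid.subset_closure (by simp)⟩

/-- The element `v`, the inverse of `v⁻¹`. -/
def v : Laurent2 := Localization.mk 1 ⟨inV X, Submonoid.subset_closure (by simp)⟩

/-- The inclusion `Λ[[u⁻¹, v⁻¹]] → Λ[[u⁻¹, v⁻¹]][u, v]`. -/
def incl : Series2 →+* Laurent2 := algebraMap Series2 Laurent2

theorem u_mul : u * incl (inU X) = 1 := by
  rw [u, incl, ← Localization.mk_one_eq_algebraMap, Localization.mk_mul, one_mul, mul_one]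
  exact Localization.mk_self (⟨inU X, Submonoid.subset_closure (by simp)⟩ : denominators)

theorem v_mul : v * incl (inV X) = 1 := by
  rw [v, incl, ← Localization.mk_one_eq_algebraMap, Localization.mk_mul, one_mul, mul_one]
  exact Localization.mk_self (⟨inV X, Submonoid.subset_closure (by simp)⟩ : denominators)

theorem incl_injective : Function.Injective incl := by
  refine IsLocalization.injective Laurent2 (M := denominators) ?_
  rw [denominators, Submonoid.closure_le]
  rintro x (rfl | rfl)
  · refine mem_nonZeroDivisors_of_ne_zero fun h => PowerSeries.X_ne_zero (R := Sym) ?_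
    exact PowerSeries.C_injective (h.trans (map_zero _).symm)
  · refine mem_nonZeroDivisors_of_ne_zero fun h =>
      PowerSeries.X_ne_zero (R := PowerSeries Sym) ?_
    simp [inV] at h

/-- A constant of `Λ` as a series in `Λ[[u⁻¹, v⁻¹]]`. -/
def const : Sym →+* Series2 := inU.comp PowerSeries.C

/-- In the ring where `u` lives, `recipPow a m` is the inverse of the product
`(u - a_1) ⋯ (u - a_m)`. -/
theorem recipPow_u (a : ℤ → ℂ) (m : ℕ) :
    (∏ i ∈ Finset.range m, (u - incl (const (MvPolynomial.C (a ((i : ℤ) + 1)))))) *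
      incl (inU (recipPow a m)) = 1 := by
  rw [recipPow, map_prod, map_prod, ← Finset.prod_mul_distrib]
  refine Finset.prod_eq_one fun i _ => ?_
  have h := congrArg (fun z => u * incl (inU z)) (recip_spec (a ((i : ℤ) + 1)))
  simp only [map_mul, map_sub, map_one, u_mul] at h
  simp only [const, RingHom.comp_apply]
  linear_combination h + (incl (inU (PowerSeries.C (MvPolynomial.C (a ((i : ℤ) + 1))))) *
    incl (inU (recip (a ((i : ℤ) + 1))))) * u_mul

/-- In the ring where `v` lives, `recipPow a m` is the inverse of the product
`(v - a_1) ⋯ (v - a_m)`. -/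
theorem recipPow_v (a : ℤ → ℂ) (m : ℕ) :
    (∏ i ∈ Finset.range m, (v - incl (const (MvPolynomial.C (a ((i : ℤ) + 1)))))) *
      incl (inV (recipPow a m)) = 1 := by
  have hc : ∀ c : Sym, inV (PowerSeries.C c) = const c := fun c => by
    simp [inV, const, inU]
  rw [recipPow, map_prod, map_prod, ← Finset.prod_mul_distrib]
  refine Finset.prod_eq_one fun i _ => ?_
  have h := congrArg (fun z => v * incl (inV z)) (recip_spec (a ((i : ℤ) + 1)))
  simp only [map_mul, map_sub, map_one, v_mul, hc] at h
  linear_combination h + (incl (const (MvPolynomial.C (a ((i : ℤ) + 1)))) *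
    incl (inV (recip (a ((i : ℤ) + 1))))) * v_mul

/-- The term `s_{(p|q);a} / ((u|a)^{p+1} (v|â)^{q+1})` of the generating series. -/
def hookTerm (a : ℤ → ℂ) (pq : ℕ × ℕ) : Series2 :=
  const (hookSchur pq.1 pq.2 a) *
    (inU (recipPow a (pq.1 + 1)) * inV (recipPow (dual a) (pq.2 + 1)))

end

end MultiSchur

namespace MultiSchur

open PowerSeries
open scoped PowerSeries.WithPiTopology

noncomputable section

/-! ### Change of parameters in the complete functions -/

/-! The core is the quadratic recurrence for hooks; the generating series identity is its summed
form. Recurrence: comparing expansions of `H` in `1/(u|a)^k` and `1/(u|τ⁻¹a)^k` gives `h_{k+1;τ⁻¹a}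
= h_{k+1;a} + (a_k - a_0) h_{k;a}` (`hRow_shift_neg_one`). A hook function is a determinant whose
rows below the first do not depend on `p`, so the first row may be replaced by an arbitrary one `x`.
For such determinants a relation linear in `x` holds (`borderedDet_recurrence`), by induction on the
order through expansion along the first column. Taking `x` to be the row of the hook `(p|q)` yields
`hookSchur_recurrence`. Summation: multiplying the recurrence by `1/((u|a)^{p+1} (v|â)^{q+1})` and
summing makes the shifted double sums differ from the unshifted ones only by boundary terms
(`add_mul_tsum_of_recurrence`). The result is `1 + (u+v)S = A(u)B(v)`, where `A` and `B` are the
series of one-row and one-column hooks. Here `A = H` by definition of `h_{k;a}`. Setting `u = -v`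
kills the double sum and leaves `H(-v)B(v) = 1`, so `B = E`. -/

theorem shift_shift (r s : ℤ) (a : ℤ → ℂ) : shift r (shift s a) = shift (r + s) a := by
  funext i
  simp [shift, add_assoc]

theorem recipPow_succ (a : ℤ → ℂ) (m : ℕ) :
    recipPow a (m + 1) = recipPow a m * recip (a ((m : ℤ) + 1)) := by
  rw [recipPow, Finset.prod_range_succ, recipPow]

theorem X_mul_recipPow (a : ℤ → ℂ) (m : ℕ) :
    X * recipPow a m =
      (1 - PowerSeries.C (MvPolynomial.C (a ((m : ℤ) + 1)) : Sym) * X) * recipPow a (m + 1) := by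
  rw [recipPow_succ]
  linear_combination (-recipPow a m) * recip_spec (a ((m : ℤ) + 1))

theorem recipPow_shift_neg_one_succ (a : ℤ → ℂ) (m : ℕ) :
    recipPow (shift (-1) a) (m + 1) = recip (a 0) * recipPow a m := by
  rw [recipPow, Finset.prod_range_succ', mul_comm]
  simp [shift, recipPow]

/-- Over the common denominator `(u - a_0) ⋯ (u - a_k)` this is `u - a_0 = (u - a_k) + (a_k - a_0)`.
-/
theorem recipPow_eq_shift_neg_one (a : ℤ → ℂ) (k : ℕ) :
    recipPow a k = recipPow (shift (-1) a) k +
      PowerSeries.C (MvPolynomial.C (a k - a 0) : Sym) * recipPow (shift (-1) a) (k + 1) := by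
  have h1 := X_mul_recipPow (shift (-1) a) k
  have h2 := recip_spec (a 0)
  have h3 := recipPow_shift_neg_one_succ a k
  have h4 : shift (-1) a ((k : ℤ) + 1) = a k := by simp [shift]
  rw [h4] at h1
  apply mul_left_cancel₀ (PowerSeries.X_ne_zero (R := Sym))
  rw [mul_add, h1, h3, map_sub, map_sub]
  linear_combination (-recipPow a k) * h2

/-- Substituting the previous identity into the expansion of `H` gives an expansion for the shifted
parameters, and such an expansion is unique by `eq_hRow`. -/
theorem hRow_shift_neg_one (a : ℤ → ℂ) (k : ℕ) :
    hRow (shift (-1) a) (k + 1) = hRow a (k + 1) +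
      MvPolynomial.C (a k - a 0) * hRow a k := by
  let g : ℕ → Sym := fun n => Nat.casesOn n 1 fun k =>
    hRow a (k + 1) + MvPolynomial.C (a k - a 0) * hRow a k
  suffices h : g = hRow (shift (-1) a) from (congrFun h (k + 1)).symm
  apply eq_hRow
  rw [hasSum_iff_sum_range]
  intro n
  rw [← sum_hRow a n]
  have key : ∀ k, hRow a k * PowerSeries.coeff n (recipPow a k) =
      hRow a k * PowerSeries.coeff n (recipPow (shift (-1) a) k) +
      MvPolynomial.C (a k - a 0) * hRow a k *
        PowerSeries.coeff n (recipPow (shift (-1) a) (k + 1)) := fun k => by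
    rw [recipPow_eq_shift_neg_one a k, map_add, PowerSeries.coeff_C_mul]
    ring
  -- The last term of the shifted sum involves `1/(u|τ⁻¹a)^{n+1}`, which has no `u^{-n}`
  -- coefficient, so both sides run over the same range.
  rw [Finset.sum_congr rfl fun k _ => key k, Finset.sum_add_distrib, Finset.sum_range_succ',
    Finset.sum_range_succ' (fun k => hRow a k * _), Finset.sum_range_succ (fun k =>
      MvPolynomial.C (a k - a 0) * hRow a k *
        PowerSeries.coeff n (recipPow (shift (-1) a) (k + 1))),
    coeff_recipPow_of_lt _ (Nat.lt_succ_self n)]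
  simp only [g, hRow_zero, add_mul, Finset.sum_add_distrib, mul_zero, add_zero]
  exact add_right_comm _ _ _

theorem hInt_natCast (a : ℤ → ℂ) (k : ℕ) : hInt a (k : ℤ) = hRow a k := rfl

theorem hInt_of_neg (a : ℤ → ℂ) {k : ℤ} (h : k < 0) : hInt a k = 0 := by
  obtain ⟨n, rfl⟩ := Int.eq_negSucc_of_lt_zero h
  rfl

/-! ### Hook functions as bordered determinants -/

/-- The row `j ↦ h_{n+j; τ^{-j} a}`. -/
def completeRow (a : ℤ → ℂ) (n : ℕ) (j : ℕ) : Sym := hRow (shift (-(j : ℤ)) a) (n + j)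

theorem completeRow_zero (a : ℤ → ℂ) (n : ℕ) : completeRow a n 0 = hRow a n := by
  rw [completeRow]
  congr 1
  funext i
  simp [shift]

theorem hRow_shift_neg_one_one (a : ℤ → ℂ) : hRow (shift (-1) a) 1 = hRow a 1 := by
  simpa using hRow_shift_neg_one a 0

/-- The determinant of order `q + 1` with first row `x` and the remaining rows those of the
determinant of a hook function. -/
def borderedDet (q : ℕ) (x : ℕ → Sym) (a : ℤ → ℂ) : Sym :=
  Matrix.det (Matrix.of fun i j : Fin (q + 1) =>
    if (i : ℕ) = 0 then x j
    else hInt (shift (-((j : ℕ) : ℤ)) a) (((j : ℕ) : ℤ) - ((i : ℕ) : ℤ) + 1))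

theorem borderedDet_zero (x : ℕ → Sym) (a : ℤ → ℂ) : borderedDet 0 x a = x 0 := by
  simp [borderedDet]

theorem shift_neg_succ (a : ℤ → ℂ) (j : ℕ) :
    shift (-((j + 1 : ℕ) : ℤ)) a = shift (-(j : ℤ)) (shift (-1) a) := by
  rw [shift_shift]
  congr 1
  push_cast
  ring

/-- The first column is `x 0, 1, 0, …, 0`, and both surviving minors are again bordered
determinants, with parameters shifted by `τ⁻¹`. -/
theorem borderedDet_succ (q : ℕ) (x : ℕ → Sym) (a : ℤ → ℂ) :
    borderedDet (q + 1) x a =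
      x 0 * borderedDet q (completeRow (shift (-1) a) 1) (shift (-1) a) -
        borderedDet q (fun j => x (j + 1)) (shift (-1) a) := by
  rw [borderedDet, Matrix.det_succ_column_zero, Fin.sum_univ_succ, Fin.sum_univ_succ,
    Finset.sum_eq_zero, add_zero, sub_eq_add_neg]
  · congr 1
    · simp only [borderedDet, Matrix.of_apply, Fin.val_zero, pow_zero, one_mul, if_true]
      congr 2
      ext1 i j
      simp only [Matrix.submatrix_apply, Matrix.of_apply, Fin.zero_succAbove, Fin.val_succ,
        Nat.succ_ne_zero, if_false, shift_neg_succ]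
      split_ifs with h
      · rw [completeRow, ← hInt_natCast, h]
        congr 1
        push_cast
        ring
      · congr 1
        push_cast
        ring
    · have h : hInt (shift (-((0 : ℕ) : ℤ)) a) (((0 : ℕ) : ℤ) - ((0 + 1 : ℕ) : ℤ) + 1) = 1 :=
        hRow_zero _
      simp only [borderedDet, Matrix.of_apply, Fin.val_succ, Fin.val_zero, Nat.succ_ne_zero,
        if_false, h]
      rw [zero_add, pow_one, mul_one, neg_one_mul]
      congr 2
      ext1 i j
      simp only [Matrix.submatrix_apply, Matrix.of_apply]
      rcases i.eq_zero_or_eq_succ with rfl | ⟨i, rfl⟩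
      · simp
      · rw [Fin.succ_succAbove_succ, Fin.zero_succAbove]
        simp only [Fin.val_succ, Nat.succ_ne_zero, if_false, shift_neg_succ]
        congr 1
        push_cast
        ring
  · intro i _
    rw [Matrix.of_apply, if_neg (by simp), hInt_of_neg]
    · simp
    · simp
      omega

theorem borderedDet_sub (q : ℕ) (x y : ℕ → Sym) (c : Sym) (a : ℤ → ℂ) :
    borderedDet q (fun j => x j - c * y j) a = borderedDet q x a - c * borderedDet q y a := by
  induction q generalizing x y a with
  | zero => simp [borderedDet_zero]
  | succ q ih =>
    rw [borderedDet_succ, borderedDet_succ, borderedDet_succ,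
      ih (fun j => x (j + 1)) fun j => y (j + 1)]
    ring

theorem completeRow_succ (a : ℤ → ℂ) (n j : ℕ) :
    completeRow a n (j + 1) = completeRow a (n + 1) j +
      MvPolynomial.C (a n - a (-(j : ℤ))) * completeRow a n j := by
  have h := hRow_shift_neg_one (shift (-(j : ℤ)) a) (n + j)
  rw [shift_shift, add_comm (-1 : ℤ), ← shift_shift, ← shift_neg_succ] at h
  rw [completeRow, completeRow, completeRow, ← add_assoc, h, add_right_comm n 1 j]
  simp [shift]

/-- The row `x` is arbitrary because the induction applies the statement both to the truncated row
`x (j + 1)` and to the row `completeRow (shift (-1) a) 1` produced by the expansion. -/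
theorem borderedDet_recurrence (q : ℕ) (x : ℕ → Sym) (a : ℤ → ℂ) :
    borderedDet q (fun j => x (j + 1) + MvPolynomial.C (a (-(j : ℤ))) * x j) a +
        borderedDet (q + 1) x a =
      x 0 * borderedDet q (completeRow a 1) a +
        MvPolynomial.C (a (-(q : ℤ))) * borderedDet q x a := by
  induction q generalizing x a with
  | zero =>
    simp only [borderedDet_succ, borderedDet_zero, completeRow_zero, Nat.cast_zero, neg_zero,
      hRow_shift_neg_one_one]
    ring
  | succ q ih =>
    set b := shift (-1) a with hb
    have ha : ∀ j : ℕ, a (-((j + 1 : ℕ) : ℤ)) = b (-(j : ℤ)) := fun j => by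
      rw [hb, shift]
      congr 1
      push_cast
      ring
    have ha0 : b 1 = a 0 := by simp [hb, shift]
    have h0 : completeRow a 1 0 = completeRow b 1 0 := by
      rw [completeRow_zero, completeRow_zero, hb, hRow_shift_neg_one_one]
    -- Up to a multiple of `completeRow b 1`, split off by linearity, the truncated row is the one
    -- to which the induction hypothesis for `completeRow b 1` applies.
    have hrow : (fun j => completeRow a 1 (j + 1)) = fun j =>
        (completeRow b 1 (j + 1) + MvPolynomial.C (b (-(j : ℤ))) * completeRow b 1 j) -
          MvPolynomial.C (a 0) * completeRow b 1 j := by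
      funext j
      have h : completeRow a 1 (j + 1) = completeRow b 2 j := by
        rw [completeRow, completeRow, shift_neg_succ, ← hb, ← add_assoc, add_right_comm]
      rw [h, completeRow_succ, map_sub, Nat.cast_one, ha0]
      ring
    have e := borderedDet_succ q (completeRow a 1) a
    rw [hrow, borderedDet_sub, ← hb, h0] at e
    have ih1 := ih (completeRow b 1) b
    have ih2 := ih (fun j => x (j + 1)) b
    rw [borderedDet_succ q, borderedDet_succ (q + 1), borderedDet_succ q x, e, ← hb]
    simp only [ha, zero_add, Nat.cast_zero, neg_zero]
    linear_combination x 0 * ih1 - ih2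

/-! ### Hook functions -/

theorem rowLen_hook_zero (p q : ℕ) : (hook p q).rowLen 0 = p + 1 :=
  YoungDiagram.rowLen_ofRowLens (w := (p + 1) :: List.replicate q 1) ⟨0, by simp⟩

theorem rowLen_hook_of_pos (p q : ℕ) {i : ℕ} (h0 : i ≠ 0) (hi : i < q + 1) :
    (hook p q).rowLen i = 1 := by
  obtain ⟨i, rfl⟩ := Nat.exists_eq_succ_of_ne_zero h0
  refine (YoungDiagram.rowLen_ofRowLens (w := (p + 1) :: List.replicate q 1)
    ⟨i + 1, by simpa using hi⟩).trans ?_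
  simp

theorem colLen_hook (p q : ℕ) : (hook p q).colLen 0 ≤ q + 1 := by
  by_contra! h
  rw [← YoungDiagram.mem_iff_lt_colLen, hook, YoungDiagram.mem_ofRowLens] at h
  simpa using h.1

theorem hookSchur_eq_borderedDet (p q : ℕ) (a : ℤ → ℂ) :
    hookSchur p q a = borderedDet q (completeRow a (p + 1)) a := by
  rw [hookSchur, ← jacobiTrudi_eq _ a (q + 1) (colLen_hook p q), jacobiTrudi, borderedDet]
  congr 2
  funext i j
  split_ifs with h
  · rw [h, rowLen_hook_zero, completeRow, ← hInt_natCast]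
    congr 1
  · rw [rowLen_hook_of_pos p q h i.2]
    congr 1
    ring

theorem hookSchur_zero_right (p : ℕ) (a : ℤ → ℂ) : hookSchur p 0 a = hRow a (p + 1) := by
  rw [hookSchur_eq_borderedDet, borderedDet_zero, completeRow_zero]

theorem hookSchur_recurrence (a : ℤ → ℂ) (p q : ℕ) :
    hookSchur (p + 1) q a + hookSchur p (q + 1) a +
        MvPolynomial.C (a ((p : ℤ) + 1) + dual a ((q : ℤ) + 1)) * hookSchur p q a =
      hookSchur p 0 a * hookSchur 0 q a := by
  have hd : dual a ((q : ℤ) + 1) = -a (-(q : ℤ)) := by simp [dual]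
  have h := borderedDet_recurrence q (completeRow a (p + 1)) a
  -- The column-dependent parameter `a_{-j}` cancels, leaving the constant `a_{p+1}`. The double
  -- negation fits the form of `borderedDet_sub`.
  have hx : (fun j => completeRow a (p + 1) (j + 1) +
        MvPolynomial.C (a (-(j : ℤ))) * completeRow a (p + 1) j) =
      fun j => completeRow a (p + 1 + 1) j -
        (-MvPolynomial.C (a ((p : ℤ) + 1))) * completeRow a (p + 1) j := by
    funext j
    rw [completeRow_succ, map_sub]
    push_cast
    ring
  rw [hx, borderedDet_sub] at h
  simp only [hookSchur_eq_borderedDet, hd, map_add, map_neg, borderedDet_zero]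
  linear_combination h

/-! ### Summation of the recurrence -/

section Telescoping

/-- Coefficients on a subfamily are extended by zero to the whole family. -/
theorem summable_of_forall_summable_mul {R ι κ : Type*} [CommRing R] [TopologicalSpace R]
    {W : κ → R} (hW : ∀ g : κ → R, Summable fun k => g k * W k) {i : ι → κ} (hi : Function.Injective i)
    (g : ι → R) : Summable fun k => g k * W (i k) := by
  have h := (hi.summable_iff (f := fun k => Function.extend i g 0 k * W k) fun x hx => by
    rw [Function.extend_apply' _ _ _ fun ⟨k, hk⟩ => hx ⟨k, hk⟩]; simp).2 (hW _)
  refine h.congr fun k => ?_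
  simp [hi.extend_apply]

variable {R : Type*} [CommRing R] [TopologicalSpace R] [IsTopologicalRing R] [T2Space R]

theorem tsum_prod_eq_tsum_zero_add {G : ℕ × ℕ → R} (hG : Summable G)
    (hG' : Summable fun pq : ℕ × ℕ => G (pq.1 + 1, pq.2))
    (hf : ∀ p, Summable fun q => G (p, q)) :
    ∑' pq, G pq = (∑' q, G (0, q)) + ∑' pq : ℕ × ℕ, G (pq.1 + 1, pq.2) := by
  have h1 := hG.hasSum.prod_fiberwise fun p => (hf p).hasSum
  have h2 := hG'.hasSum.prod_fiberwise fun p => (hf (p + 1)).hasSum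
  have h3 := (hasSum_nat_add_iff (f := fun p => ∑' q, G (p, q)) 1).1 h2
  rw [h1.unique h3, Finset.sum_range_one, add_comm]

/-- Here `x`, `y` play the roles of `u⁻¹`, `v⁻¹`; the factor `x * y` avoids inverting them. The ring
is abstract because the lemma serves both in two independent variables and on the line `u = -v`. -/
theorem add_mul_tsum_of_recurrence {x y : R} {U V α β : ℕ → R} {s : ℕ → ℕ → R}
    (hU0 : U 0 = 1) (hV0 : V 0 = 1)
    (hU : ∀ p, x * U p = (1 - α p * x) * U (p + 1))
    (hV : ∀ q, y * V q = (1 - β q * y) * V (q + 1))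
    (hs : ∀ p q, s (p + 1) q + s p (q + 1) + (α p + β q) * s p q = s p 0 * s 0 q)
    (hW : ∀ g : ℕ × ℕ → R, Summable fun pq => g pq * (U pq.1 * V pq.2)) :
    x * y + (x + y) * ∑' pq : ℕ × ℕ, s pq.1 pq.2 * (U (pq.1 + 1) * V (pq.2 + 1)) =
      x * y * ((1 + ∑' p, s p 0 * U (p + 1)) * (1 + ∑' q, s 0 q * V (q + 1))) := by
  have inj : ∀ m n : ℕ, Function.Injective fun pq : ℕ × ℕ => (pq.1 + m, pq.2 + n) := by
    rintro m n ⟨p, q⟩ ⟨p', q'⟩ h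
    simpa using h
  have sm : ∀ (m n : ℕ) (g : ℕ × ℕ → R),
      Summable fun pq : ℕ × ℕ => g pq * (U (pq.1 + m) * V (pq.2 + n)) := fun m n g =>
    summable_of_forall_summable_mul hW (inj m n) g
  have su : ∀ (m n : ℕ) (g : ℕ → R), Summable fun p : ℕ => g p * (U (p + m) * V n) :=
    fun m n g => summable_of_forall_summable_mul hW (i := fun p => (p + m, n))
      (fun p p' h => by simpa using h) g
  have sv : ∀ (m n : ℕ) (g : ℕ → R), Summable fun q : ℕ => g q * (U m * V (q + n)) :=
    fun m n g => summable_of_forall_summable_mul hW (i := fun q => (m, q + n))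
      (fun p p' h => by simpa using h) g
  have sA : Summable fun p => s p 0 * U (p + 1) := by
    simpa [hV0] using su 1 0 fun p => s p 0
  have sB : Summable fun q => s 0 q * V (q + 1) := by
    simpa [hU0] using sv 0 1 fun q => s 0 q
  have e1 := tsum_prod_eq_tsum_zero_add (sm 0 1 fun pq => s pq.1 pq.2)
    (sm 1 1 fun pq => s (pq.1 + 1) pq.2) fun p => sv p 1 fun q => s p q
  have e2 : ∑' pq : ℕ × ℕ, s pq.1 pq.2 * (U (pq.1 + 1) * V pq.2) =
      (∑' p, s p 0 * (U (p + 1) * V 0)) +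
        ∑' pq : ℕ × ℕ, s pq.1 (pq.2 + 1) * (U (pq.1 + 1) * V (pq.2 + 1)) := by
    have sw := (Equiv.prodComm ℕ ℕ).summable_iff (f := fun pq : ℕ × ℕ =>
      s pq.1 pq.2 * (U (pq.1 + 1) * V pq.2)) |>.2 (sm 1 0 _)
    have sw' := (Equiv.prodComm ℕ ℕ).summable_iff (f := fun pq : ℕ × ℕ =>
      s pq.1 (pq.2 + 1) * (U (pq.1 + 1) * V (pq.2 + 1))) |>.2 (sm 1 1 _)
    have h := tsum_prod_eq_tsum_zero_add sw sw' fun q => su 1 q fun p => s p q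
    refine ((Equiv.prodComm ℕ ℕ).tsum_eq fun pq : ℕ × ℕ =>
      s pq.1 pq.2 * (U (pq.1 + 1) * V pq.2)).symm.trans (h.trans (congrArg _ ?_))
    exact (Equiv.prodComm ℕ ℕ).tsum_eq fun pq : ℕ × ℕ =>
      s pq.1 (pq.2 + 1) * (U (pq.1 + 1) * V (pq.2 + 1))
  have e3 : (∑' p, s p 0 * U (p + 1)) * (∑' q, s 0 q * V (q + 1)) =
      ∑' pq : ℕ × ℕ, s pq.1 0 * s 0 pq.2 * (U (pq.1 + 1) * V (pq.2 + 1)) := by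
    rw [sA.tsum_mul_tsum sB ((sm 1 1 fun pq => s pq.1 0 * s 0 pq.2).congr fun pq => by ring)]
    exact tsum_congr fun pq => by ring
  have e4 : ∑' pq : ℕ × ℕ, s pq.1 0 * s 0 pq.2 * (U (pq.1 + 1) * V (pq.2 + 1)) =
      (∑' pq : ℕ × ℕ, s (pq.1 + 1) pq.2 * (U (pq.1 + 1) * V (pq.2 + 1))) +
      (∑' pq : ℕ × ℕ, s pq.1 (pq.2 + 1) * (U (pq.1 + 1) * V (pq.2 + 1))) +
      ∑' pq : ℕ × ℕ, (α pq.1 + β pq.2) * s pq.1 pq.2 * (U (pq.1 + 1) * V (pq.2 + 1)) := by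
    rw [← (sm 1 1 _).tsum_add (sm 1 1 _), ← ((sm 1 1 _).add (sm 1 1 _)).tsum_add (sm 1 1 _)]
    exact tsum_congr fun pq => by rw [← hs]; ring
  -- Termwise, this uses `U (p+1) = x (U p + α p U (p+1))` and its analogue for `V`.
  have e5 : (x + y) * ∑' pq : ℕ × ℕ, s pq.1 pq.2 * (U (pq.1 + 1) * V (pq.2 + 1)) =
      x * y * ((∑' pq : ℕ × ℕ, s pq.1 pq.2 * (U pq.1 * V (pq.2 + 1))) +
      (∑' pq : ℕ × ℕ, s pq.1 pq.2 * (U (pq.1 + 1) * V pq.2)) +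
      ∑' pq : ℕ × ℕ, (α pq.1 + β pq.2) * s pq.1 pq.2 * (U (pq.1 + 1) * V (pq.2 + 1))) := by
    have t1 := sm 0 1 fun pq => s pq.1 pq.2
    have t2 := sm 1 0 fun pq => s pq.1 pq.2
    have t3 := sm 1 1 fun pq => (α pq.1 + β pq.2) * s pq.1 pq.2
    simp only [add_zero] at t1 t2
    rw [← t1.tsum_add t2, ← (t1.add t2).tsum_add t3,
      ← ((t1.add t2).add t3).tsum_mul_left, ← (sm 1 1 _).tsum_mul_left]
    refine tsum_congr fun pq => ?_
    linear_combination (-s pq.1 pq.2 * V (pq.2 + 1) * y) * hU pq.1 +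
      (-s pq.1 pq.2 * U (pq.1 + 1) * x) * hV pq.2
  simp only [add_zero, hU0, hV0, one_mul, mul_one] at e1 e2
  rw [e5]
  linear_combination (x * y) * (e1 + e2 - e3 - e4)

end Telescoping

/-! ### The generating series -/

theorem X_pow_dvd_recipPow (a : ℤ → ℂ) (m : ℕ) : (X : PowerSeries Sym) ^ m ∣ recipPow a m := by
  obtain ⟨g, -, hg⟩ := recipPow_eq a m
  exact ⟨g, hg⟩

theorem coeff_eq_zero_of_X_pow_dvd {R : Type*} [CommRing R] {m n : ℕ} {f : PowerSeries R}
    (hf : X ^ m ∣ f) (h : n < m) : PowerSeries.coeff n f = 0 :=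
  PowerSeries.X_pow_dvd_iff.1 hf n h

theorem hasSum_H (a : ℤ → ℂ) :
    HasSum (fun p => PowerSeries.C (hookSchur p 0 a) * recipPow a (p + 1)) (H - 1) := by
  have h := (hasSum_nat_add_iff' 1).2 (hasSum_hRow a)
  simpa [hookSchur_zero_right, hRow_zero, recipPow] using h

theorem continuous_evalNegHom : Continuous (PowerSeries.evalNegHom (A := Sym)) := by
  rw [continuous_iff_continuousAt]
  intro f
  rw [ContinuousAt, PowerSeries.WithPiTopology.tendsto_iff_coeff_tendsto]
  intro d
  simp only [PowerSeries.evalNegHom, PowerSeries.coeff_rescale]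
  exact ((PowerSeries.WithPiTopology.continuous_coeff Sym d).tendsto f).const_mul _

theorem evalNegHom_evalNegHom (f : PowerSeries Sym) :
    PowerSeries.evalNegHom (PowerSeries.evalNegHom f) = f := by
  simp [PowerSeries.evalNegHom, PowerSeries.rescale_rescale]

theorem evalNegHom_C (c : Sym) : PowerSeries.evalNegHom (PowerSeries.C c) = PowerSeries.C c := by
  ext n
  rcases n with _ | n <;> simp [PowerSeries.evalNegHom, PowerSeries.coeff_C]

/-- No separate computation of one-column functions is needed: the summed recurrence at `u = -v`
shows that `1` plus this series is inverse to `H(-v)`, as `E(v)` is. -/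
theorem hasSum_E (a : ℤ → ℂ) :
    HasSum (fun q => PowerSeries.C (hookSchur 0 q a) * recipPow (dual a) (q + 1)) (E - 1) := by
  have hW : ∀ g : ℕ × ℕ → PowerSeries Sym, Summable fun pq =>
      g pq * (PowerSeries.evalNegHom (recipPow a pq.1) * recipPow (dual a) pq.2) := by
    intro g
    rw [PowerSeries.WithPiTopology.summable_iff_summable_coeff]
    intro n
    refine summable_of_ne_finset_zero
      (s := Finset.range (n + 1) ×ˢ Finset.range (n + 1)) fun pq hpq => ?_
    rw [Finset.mem_product, Finset.mem_range, Finset.mem_range, not_and_or] at hpq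
    rcases hpq with h | h
    · refine coeff_eq_zero_of_X_pow_dvd (m := pq.1)
        (dvd_mul_of_dvd_right (dvd_mul_of_dvd_left ?_ _) _) (by omega)
      have := map_dvd PowerSeries.evalNegHom (X_pow_dvd_recipPow a pq.1)
      rwa [map_pow, PowerSeries.evalNegHom_X, neg_pow,
        (isUnit_one.neg.pow _).mul_left_dvd] at this
    · exact coeff_eq_zero_of_X_pow_dvd (m := pq.2)
        (dvd_mul_of_dvd_right (dvd_mul_of_dvd_right (X_pow_dvd_recipPow _ _) _) _) (by omega)
  have hsum : Summable fun q =>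
      PowerSeries.C (hookSchur 0 q a) * recipPow (dual a) (q + 1) := by
    have h := summable_of_forall_summable_mul hW (i := fun q : ℕ => (0, q + 1))
      (fun p p' h => by simpa using h) fun q => PowerSeries.C (hookSchur 0 q a)
    simpa [recipPow] using h
  have hH : HasSum (fun p => PowerSeries.C (hookSchur p 0 a) *
      PowerSeries.evalNegHom (recipPow a (p + 1))) (PowerSeries.evalNegHom H - 1) := by
    have h := (hasSum_H a).map PowerSeries.evalNegHom continuous_evalNegHom
    simpa [Function.comp_def, evalNegHom_C] using h
  -- With `x + y = 0` the double sum disappears.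
  have key := add_mul_tsum_of_recurrence (x := -X) (y := X)
    (U := fun p => PowerSeries.evalNegHom (recipPow a p)) (V := recipPow (dual a))
    (α := fun p => PowerSeries.C (MvPolynomial.C (a ((p : ℤ) + 1))))
    (β := fun q => PowerSeries.C (MvPolynomial.C (dual a ((q : ℤ) + 1))))
    (s := fun p q => PowerSeries.C (hookSchur p q a))
    (by simp [recipPow]) (by simp [recipPow])
    (fun p => by
      have h := congrArg PowerSeries.evalNegHom (X_mul_recipPow a p)
      simpa only [map_mul, map_sub, map_one, evalNegHom_C, PowerSeries.evalNegHom_X] using h)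
    (fun q => X_mul_recipPow _ q)
    (fun p q => by
      simp only [← map_add, ← map_mul, hookSchur_recurrence])
    hW
  rw [hH.tsum_eq, neg_add_cancel, zero_mul, add_zero, add_sub_cancel] at key
  have hX : (-X * X : PowerSeries Sym) ≠ 0 :=
    mul_ne_zero (neg_ne_zero.2 PowerSeries.X_ne_zero) PowerSeries.X_ne_zero
  have key' := mul_left_cancel₀ hX ((mul_one _).trans key)
  have hE := congrArg PowerSeries.evalNegHom H_mul_E_neg
  rw [map_mul, map_one, evalNegHom_evalNegHom] at hE
  have hne : PowerSeries.evalNegHom H ≠ 0 := left_ne_zero_of_mul_eq_one hE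
  have := mul_left_cancel₀ hne (key'.symm.trans hE.symm)
  rw [← this, add_sub_cancel_left]
  exact hsum.hasSum

theorem inU_C (c : Sym) : inU (PowerSeries.C c) = const c := rfl

theorem inV_C (c : Sym) : inV (PowerSeries.C c) = const c := by
  simp [inV, const, inU]

theorem continuous_inU : Continuous inU := PowerSeries.WithPiTopology.continuous_C

theorem continuous_inV : Continuous inV := by
  rw [continuous_iff_continuousAt]
  intro f
  rw [ContinuousAt, PowerSeries.WithPiTopology.tendsto_iff_coeff_tendsto]
  intro d
  simp only [inV, PowerSeries.coeff_map]
  exact ((PowerSeries.WithPiTopology.continuous_C).comp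
    (PowerSeries.WithPiTopology.continuous_coeff Sym d)).tendsto f

theorem summable_mul_recipPow (a b : ℤ → ℂ) (g : ℕ × ℕ → Series2) :
    Summable fun pq => g pq * (inU (recipPow a pq.1) * inV (recipPow b pq.2)) := by
  rw [PowerSeries.WithPiTopology.summable_iff_summable_coeff]
  intro n
  rw [PowerSeries.WithPiTopology.summable_iff_summable_coeff]
  intro m
  refine summable_of_ne_finset_zero
    (s := Finset.range (m + 1) ×ˢ Finset.range (n + 1)) fun pq hpq => ?_
  rw [Finset.mem_product, Finset.mem_range, Finset.mem_range, not_and_or] at hpq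
  rcases hpq with h | h
  · rw [mul_left_comm, inU, PowerSeries.coeff_C_mul]
    exact coeff_eq_zero_of_X_pow_dvd (m := pq.1)
      (dvd_mul_of_dvd_left (X_pow_dvd_recipPow _ _) _) (by omega)
  · have hd : (X : Series2) ^ pq.2 ∣ inV (recipPow b pq.2) := by
      have := map_dvd inV (X_pow_dvd_recipPow b pq.2)
      rwa [map_pow, inV, PowerSeries.map_X] at this
    have h0 : PowerSeries.coeff n
        (g pq * (inU (recipPow a pq.1) * inV (recipPow b pq.2))) = 0 :=
      coeff_eq_zero_of_X_pow_dvd (m := pq.2)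
        (dvd_mul_of_dvd_right (dvd_mul_of_dvd_right hd _) _) (by omega)
    rw [h0, map_zero]

theorem summable_hookTerm (a : ℤ → ℂ) : Summable (hookTerm a) :=
  summable_of_forall_summable_mul (summable_mul_recipPow a (dual a))
    (i := fun pq : ℕ × ℕ => (pq.1 + 1, pq.2 + 1))
    (fun pq pq' h => by simpa [Prod.ext_iff] using h) fun pq => const (hookSchur pq.1 pq.2 a)

theorem add_mul_tsum_hookTerm (a : ℤ → ℂ) :
    inU X * inV X + (inU X + inV X) * ∑' pq, hookTerm a pq =
      inU X * inV X * (inU H * inV E) := by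
  have hA : HasSum (fun p => const (hookSchur p 0 a) * inU (recipPow a (p + 1)))
      (inU H - 1) := by
    have h := (hasSum_H a).map inU continuous_inU
    simpa only [Function.comp_def, map_mul, map_sub, map_one, inU_C] using h
  have hB : HasSum (fun q => const (hookSchur 0 q a) * inV (recipPow (dual a) (q + 1)))
      (inV E - 1) := by
    have h := (hasSum_E a).map inV continuous_inV
    simpa only [Function.comp_def, map_mul, map_sub, map_one, inV_C] using h
  have key := add_mul_tsum_of_recurrence (x := inU X) (y := inV X)
    (U := fun p => inU (recipPow a p)) (V := fun q => inV (recipPow (dual a) q))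
    (α := fun p => const (MvPolynomial.C (a ((p : ℤ) + 1))))
    (β := fun q => const (MvPolynomial.C (dual a ((q : ℤ) + 1))))
    (s := fun p q => const (hookSchur p q a))
    (by simp [recipPow]) (by simp [recipPow])
    (fun p => by
      have h := congrArg inU (X_mul_recipPow a p)
      simpa only [map_mul, map_sub, map_one, inU_C] using h)
    (fun q => by
      have h := congrArg inV (X_mul_recipPow (dual a) q)
      simpa only [map_mul, map_sub, map_one, inV_C] using h)
    (fun p q => by
      simp only [← map_add, ← map_mul, hookSchur_recurrence])
    (summable_mul_recipPow a (dual a))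
  rwa [hA.tsum_eq, hB.tsum_eq, add_sub_cancel, add_sub_cancel] at key

end

end MultiSchur

open MultiSchur in
open scoped PowerSeries.WithPiTopology in
theorem proposition7p1 (a : ℤ → ℂ) :
    (Summable (hookTerm a) ∧
      1 + (u + v) * incl (∑' pq : ℕ × ℕ, hookTerm a pq) = incl (inU H * inV E)) ∧
    ∀ p q : ℕ,
      hookSchur (p + 1) q a + hookSchur p (q + 1) a +
          MvPolynomial.C (a ((p : ℤ) + 1) + dual a ((q : ℤ) + 1)) * hookSchur p q a =
        hookSchur p 0 a * hookSchur 0 q a := by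
  refine ⟨⟨summable_hookTerm a, ?_⟩, hookSchur_recurrence a⟩
  -- Multiplication by `u v` turns `u⁻¹ + v⁻¹` into `u + v` and cancels `u⁻¹ v⁻¹`.
  have h := congrArg (fun z => u * v * incl z) (add_mul_tsum_hookTerm a)
  simp only [map_add, map_mul] at h
  rw [map_mul]
  have hu := u_mul
  have hv := v_mul
  set S := incl (∑' pq, hookTerm a pq)
  set F := incl (inU H) * incl (inV E)
  have huv : u * v * (incl (inU PowerSeries.X) * incl (inV PowerSeries.X)) = 1 := by
    rw [mul_mul_mul_comm, hu, hv, one_mul]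
  linear_combination h + (F - 1) * huv - v * S * hu - u * S * hv
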